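/- All rings are commutative with $1$. Let $R$ be any ring, let $s_1,s_2,s_3,s_4\in R$, put $f(x)=x^4-s_1x^3+s_2x^2-s_3x+s_4$, and let $A=R[x]/(f(x))$, a free $R$-algebra of rank $4$. For a subgroup $G$ of the symmetric group $S_4$, let $(A^{\otimes 4})^G$ be the $R$-subalgebra of tensors in $A^{\otimes 4}$ (tensor power over $R$) that are fixed by $G$ permuting the tensor factors. For $a\in A$ and $1\le k\le 4$, let $e_k(a)\in (A^{\otimes 4})^{G}$ be the $k$-th elementary symmetric polynomial evaluated at $a\otimes1\otimes1\otimes1,\ \dots,\ 1\otimes1\otimes1\otimes a$, and let $s_k(a)\in R$ be defined by writing the characteristic polynomial of multiplication by $a$ on $A$ as $\lambda^4-s_1(a)\lambda^3+s_2(a)\lambda^2-s_3(a)\lambda+s_4(a)$. A $G$-closure datum for $A$ over $R$ is an $R$-algebra homomorphism $\varphi:(A^{\otimes 4})^G\to R$ such that $\varphi(e_k(a))=s_k(a)$ for all $a\in A$ and all $k\in\{1,2,3,4\}$. Theorem. Let $D_4=\langle(13),(1234)\rangle\subset S_4$. Then the map $$\varphi\ \longmapsto\ \varphi\bigl(x\otimes1\otimes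 x\otimes1+1\otimes x\otimes1\otimes x\bigr)$$ is a bijection from the set of $D_4$-closure data for $A$ over $R$ to the set of roots in $R$ of the cubic resolvent $$y^3-s_2y^2+(s_1s_3-4s_4)y-(s_1^2s_4-4s_2s_4+s_3^2).$$ -/

import Mathlib

open scoped TensorProduct

noncomputable section

namespace GClosure

section General

variable (R : Type*) [CommRing R] (A : Type*) [CommRing A] [Algebra R A] (n : ℕ)

/-- The `n`-th tensor power `A^{⊗n}` of `A` over `R`. -/
abbrev TensorPow : Type _ := ⨂[R] _ : Fin n, A

variable {A n}

/-- The `i`-th conjugate `1 ⊗ ⋯ ⊗ a ⊗ ⋯ ⊗ 1` of `a`, with `a` in the `i`-th tensor factor. -/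
def conj (i : Fin n) (a : A) : TensorPow R A n :=
  PiTensorProduct.singleAlgHom (R := R) (A := fun _ : Fin n => A) i a

variable (A)

/-- The action of a permutation `σ` on `A^{⊗n}`: the factor in position `i` is moved to
position `σ i`. -/
def permute (σ : Equiv.Perm (Fin n)) : TensorPow R A n →ₐ[R] TensorPow R A n :=
  PiTensorProduct.liftAlgHom
    ((PiTensorProduct.tprod R (s := fun _ : Fin n => A)).domDomCongr σ.symm)
    (by rfl)
    (by
      intro x y
      simp only [MultilinearMap.domDomCongr_apply]
      rw [PiTensorProduct.tprod_mul_tprod]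
      rfl)

variable {A}

theorem permute_tprod (σ : Equiv.Perm (Fin n)) (v : Fin n → A) :
    permute R A σ (PiTensorProduct.tprod R v) = PiTensorProduct.tprod R (fun i => v (σ.symm i)) := by
  change PiTensorProduct.lift _ (PiTensorProduct.tprod R v) = _
  rw [PiTensorProduct.lift.tprod]
  rfl

theorem permute_conj (σ : Equiv.Perm (Fin n)) (i : Fin n) (a : A) :
    permute R A σ (conj R i a) = conj R (σ i) a := by
  simp only [conj, PiTensorProduct.singleAlgHom_apply]
  erw [permute_tprod]
  congr 1
  funext j
  by_cases h : j = σ i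
  · subst h; simp
  · have h' : σ.symm j ≠ i := fun e => h (by simp [← e])
    simp [h, h']

theorem permute_mul (σ τ : Equiv.Perm (Fin n)) (t : TensorPow R A n) :
    permute R A (σ * τ) t = permute R A σ (permute R A τ t) := by
  suffices h : permute R A (σ * τ) = (permute R A σ).comp (permute R A τ) by rw [h]; rfl
  apply PiTensorProduct.algHom_ext
  intro i
  ext a
  change permute R A (σ * τ) (conj R i a) = permute R A σ (permute R A τ (conj R i a))
  simp [permute_conj]

theorem permute_one (t : TensorPow R A n) :
    permute R A (1 : Equiv.Perm (Fin n)) t = t := by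
  suffices h : permute R A (1 : Equiv.Perm (Fin n)) = AlgHom.id R _ by rw [h]; rfl
  apply PiTensorProduct.algHom_ext
  intro i
  ext a
  change permute R A (1 : Equiv.Perm (Fin n)) (conj R i a) = conj R i a
  simp [permute_conj]

variable (A)

/-- The subalgebra `(A^{⊗n})^G` of tensors fixed by every element of `G`. -/
def invariants (G : Subgroup (Equiv.Perm (Fin n))) : Subalgebra R (TensorPow R A n) where
  carrier := {t | ∀ σ ∈ G, permute R A σ t = t}
  mul_mem' := fun hs ht σ hσ => by rw [map_mul, hs σ hσ, ht σ hσ]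
  add_mem' := fun hs ht σ hσ => by rw [map_add, hs σ hσ, ht σ hσ]
  algebraMap_mem' := fun r σ _ => AlgHom.commutes _ r

variable {A}

/-- A tensor fixed by the elements of a generating set is fixed by the generated subgroup. -/
theorem mem_invariants_closure {S : Set (Equiv.Perm (Fin n))} {t : TensorPow R A n}
    (h : ∀ σ ∈ S, permute R A σ t = t) : t ∈ invariants R A (Subgroup.closure S) := by
  intro σ hσ
  induction hσ using Subgroup.closure_induction with
  | mem x hx => exact h x hx
  | one => exact permute_one R t
  | mul x y _ _ hx hy => rw [permute_mul, hy, hx]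
  | inv x _ hx =>
    conv_lhs => rw [← hx]
    rw [← permute_mul, inv_mul_cancel, permute_one]

/-- `e_k(a)`: the `k`-th elementary symmetric polynomial evaluated at the `n` conjugates of `a`
in `A^{⊗n}`, as an element of `(A^{⊗n})^G`. -/
def e (G : Subgroup (Equiv.Perm (Fin n))) (k : ℕ) (a : A) : invariants R A G :=
  ⟨MvPolynomial.aeval (fun i : Fin n => conj R i a) (MvPolynomial.esymm (Fin n) R k), by
    intro σ _
    rw [← AlgHom.comp_apply, MvPolynomial.comp_aeval]
    conv_rhs => rw [← MvPolynomial.rename_esymm (Fin n) R k σ, MvPolynomial.aeval_rename]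
    simp only [Function.comp_def, permute_conj]⟩

variable (n)

/-- `s_k(a)`: the coefficient of `(-1)^k λ^(n-k)` in the characteristic polynomial of
multiplication by `a` on the free rank-`n` algebra `A`. -/
def s [Module.Free R A] [Module.Finite R A] (k : ℕ) (a : A) : R :=
  (-1) ^ k * (LinearMap.charpoly (Algebra.lmul R A a)).coeff (n - k)

variable (A)

/-- A `G`-closure datum for a (free) rank-`n` algebra `A` over `R`: an `R`-algebra homomorphism
`(A^{⊗n})^G → R` sending `e_k(a)` to `s_k(a)` for all `a ∈ A` and `k ∈ {1, …, n}`. -/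
@[ext] structure ClosureDatum [Module.Free R A] [Module.Finite R A]
    (G : Subgroup (Equiv.Perm (Fin n))) where
  toAlgHom : invariants R A G →ₐ[R] R
  map_e : ∀ (a : A) (k : ℕ), 1 ≤ k → k ≤ n → toAlgHom (e R G k a) = s R n k a

end General

section Quartic

/-- `D₄ = ⟨(13), (1234)⟩ ⊂ S₄`, with `{1, 2, 3, 4}` renumbered as `{0, 1, 2, 3}`;
`finRotate 4` is the 4-cycle `0 ↦ 1 ↦ 2 ↦ 3 ↦ 0`. -/
def D4 : Subgroup (Equiv.Perm (Fin 4)) :=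
  Subgroup.closure {Equiv.swap 0 2, finRotate 4}

variable {R : Type*} [CommRing R]

open Polynomial in
/-- `f(x) = x⁴ - s₁x³ + s₂x² - s₃x + s₄`. -/
def quartic (s₁ s₂ s₃ s₄ : R) : R[X] :=
  X ^ 4 - C s₁ * X ^ 3 + C s₂ * X ^ 2 - C s₃ * X + C s₄

open Polynomial in
/-- The cubic resolvent of `x⁴ - s₁x³ + s₂x² - s₃x + s₄`. -/
def cubicResolvent (s₁ s₂ s₃ s₄ : R) : R[X] :=
  X ^ 3 - C s₂ * X ^ 2 + C (s₁ * s₃ - 4 * s₄) * X - C (s₁ ^ 2 * s₄ - 4 * s₂ * s₄ + s₃ ^ 2)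

theorem quartic_monic (s₁ s₂ s₃ s₄ : R) : (quartic s₁ s₂ s₃ s₄).Monic := by
  unfold quartic
  monicity!

instance (s₁ s₂ s₃ s₄ : R) : Module.Free R (AdjoinRoot (quartic s₁ s₂ s₃ s₄)) :=
  (quartic_monic s₁ s₂ s₃ s₄).free_adjoinRoot

instance (s₁ s₂ s₃ s₄ : R) : Module.Finite R (AdjoinRoot (quartic s₁ s₂ s₃ s₄)) :=
  (quartic_monic s₁ s₂ s₃ s₄).finite_adjoinRoot

variable (R) {A : Type*} [CommRing A] [Algebra R A]

/-- `Λ(a) = a ⊗ 1 ⊗ a ⊗ 1 + 1 ⊗ a ⊗ 1 ⊗ a`, as an element of `(A^{⊗4})^{D₄}`. -/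
def Lam (a : A) : invariants R A D4 :=
  ⟨conj R 0 a * conj R 2 a + conj R 1 a * conj R 3 a, by
    apply mem_invariants_closure
    rintro σ (rfl | rfl)
    · simp only [map_add, map_mul, permute_conj]
      rw [show (Equiv.swap (0 : Fin 4) 2) 0 = 2 by decide,
        show (Equiv.swap (0 : Fin 4) 2) 1 = 1 by decide,
        show (Equiv.swap (0 : Fin 4) 2) 2 = 0 by decide,
        show (Equiv.swap (0 : Fin 4) 2) 3 = 3 by decide]
      ring
    · simp only [map_add, map_mul, permute_conj]
      rw [show finRotate 4 0 = 1 by decide, show finRotate 4 1 = 2 by decide,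
        show finRotate 4 2 = 3 by decide, show finRotate 4 3 = 0 by decide]
      ring⟩

end Quartic

end GClosure

end

/-!
Write `Λ = x₀x₂ + x₁x₃`. The `D₄`-invariants of four elements are generated by their elementary
symmetric functions together with `Λ`, over an arbitrary base ring
(`sum_pow_mem_smul_adjoin_dihedralGen`). Indeed `D₄ = S₂ ≀ S₂`, so an invariant combination of
monomials is a combination of products `P P'` and sums `P Q' + Q P'`, where `P, Q` are polynomials
in `x₀ + x₂, x₀x₂`, and `P', Q'` are the same polynomials in `x₁ + x₃, x₁x₃`; over the proposed
subalgebra the pairs `(P, P')` are spanned by four explicit ones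
(`exists_coeff_of_mem_adjoin_pair`). Hence a closure datum is determined by its value
at `Λ(x)`, and this value is a root of the resolvent because `Λ` is a root of the resolvent of
`∏ (T - xᵢ)`.

Conversely, let `y` be a root. The assignment `e_k ↦ s_k`, `Λ ↦ y` has to respect all relations
among the generators of the invariants of `A^{⊗4}`. This is reduced to the generic quartic over
`R[t₁, …, t₄]`. There the tensor power maps to the polynomial ring `R[X₀, …, X₃]` with
`t_k ↦ e_k(X)`, and the only relation of `Λ(X)` over the symmetric polynomials is the resolvent,
since the differences of the conjugates of `Λ(X)` are regular
(`eq_zero_of_quadratic_eq_zero`, `eval₂Hom_eq_zero_of_isRoot`). To descend to the given quartic,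
suppose that a generic invariant specializes to zero; its coordinates in the monomial basis lie in
the kernel of `t ↦ s`, so it can be rewritten with coefficients in that kernel
(`mem_smul_adjoin_of_mem_invariants`), and such an expression is sent to zero
(`eval₂Hom_eq_zero_of_specializeTensor_eq_zero`). The detour is needed: the quotient of
`R[X₀, …, X₃]` by `e_k(X) - s_k` need not contain the quotient of the invariants, for instance in
characteristic two.

The condition on `e_k(a)` is also checked generically: over `R[X₀, …, X₃]` the Vandermonde matrix
diagonalizes multiplication by `a`, so that `s_k(a)` becomes the `k`-th elementary symmetric
function of the conjugates of `a` (`esymmHom_s`).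
-/

open scoped TensorProduct

noncomputable section

namespace GClosure

/-! ### Symmetric sums over pairs -/

section SymmetricSums

variable {Z : Type*} [Fintype Z] [DecidableEq Z] {M : Type*} [AddCommMonoid M]

/-- The sum of `F` over all ordered pairs with a given underlying unordered pair. -/
def orbitSum (F : Z → Z → M) (z : Sym2 Z) : M :=
  ∑ p : Z × Z with s(p.1, p.2) = z, F p.1 p.2

theorem orbitSum_diag (F : Z → Z → M) (i : Z) : orbitSum F s(i, i) = F i i := by
  have h : (Finset.univ.filter fun p : Z × Z => s(p.1, p.2) = s(i, i)) = {(i, i)} := by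
    ext ⟨p, q⟩
    simp
  rw [orbitSum, h, Finset.sum_singleton]

theorem orbitSum_of_ne (F : Z → Z → M) {i j : Z} (hij : i ≠ j) :
    orbitSum F s(i, j) = F i j + F j i := by
  have h : (Finset.univ.filter fun p : Z × Z => s(p.1, p.2) = s(i, j)) = {(i, j), (j, i)} := by
    ext ⟨p, q⟩
    simp
  rw [orbitSum, h, Finset.sum_pair (by simp [hij])]

theorem sum_smul_eq_sum_orbitSum {R : Type*} [CommSemiring R] [Module R M] (c : Z → Z → R)
    (hc : ∀ i j, c i j = c j i) (F : Z → Z → M) :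
    ∑ p : Z × Z, c p.1 p.2 • F p.1 p.2 = ∑ z : Sym2 Z, Sym2.lift ⟨c, hc⟩ z • orbitSum F z := by
  rw [← Finset.sum_fiberwise (g := fun p : Z × Z => s(p.1, p.2))]
  refine Finset.sum_congr rfl fun z _ => ?_
  rw [orbitSum, Finset.smul_sum]
  refine Finset.sum_congr rfl fun p hp => ?_
  rw [← (Finset.mem_filter.mp hp).2, Sym2.lift_mk]

theorem sum_smul_mem_smul {R : Type*} [CommSemiring R] [Module R M] {I : Ideal R}
    {N : Submodule R M} {c : Z → Z → R} (hc : ∀ i j, c i j = c j i) (hI : ∀ i j, c i j ∈ I)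
    {F : Z → Z → M} (hdiag : ∀ i, F i i ∈ N) (hne : ∀ i j, F i j + F j i ∈ N) :
    ∑ p : Z × Z, c p.1 p.2 • F p.1 p.2 ∈ I • N := by
  rw [sum_smul_eq_sum_orbitSum c hc]
  refine Submodule.sum_mem _ fun z _ => ?_
  induction z with | _ i j
  refine Submodule.smul_mem_smul (hI i j) ?_
  by_cases hij : i = j
  · subst hij
    rw [orbitSum_diag]
    exact hdiag i
  · rw [orbitSum_of_ne F hij]
    exact hne i j

end SymmetricSums

/-! ### Invariants of the dihedral group -/

section Dihedral

variable {R D : Type*} [CommRing R] [CommRing D] [Algebra R D]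

theorem pow_add_pow_mem_adjoin (ξ η : D) (n : ℕ) :
    ξ ^ n + η ^ n ∈ Algebra.adjoin R {ξ + η, ξ * η} := by
  have h₁ : ξ + η ∈ Algebra.adjoin R {ξ + η, ξ * η} := Algebra.subset_adjoin (by simp)
  have h₂ : ξ * η ∈ Algebra.adjoin R {ξ + η, ξ * η} := Algebra.subset_adjoin (by simp)
  induction n using Nat.strong_induction_on with
  | _ n ih =>
    match n, ih with
    | 0, _ => simpa using add_mem (one_mem _) (one_mem _)
    | 1, _ => simpa using h₁
    | n + 2, ih =>
      have h : ξ ^ (n + 2) + η ^ (n + 2) =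
          (ξ + η) * (ξ ^ (n + 1) + η ^ (n + 1)) - ξ * η * (ξ ^ n + η ^ n) := by ring
      rw [h]
      exact sub_mem (mul_mem h₁ (ih _ (by omega))) (mul_mem h₂ (ih _ (by omega)))

theorem pow_mul_pow_add_mem_adjoin (ξ η : D) (i j : ℕ) :
    ξ ^ i * η ^ j + ξ ^ j * η ^ i ∈ Algebra.adjoin R {ξ + η, ξ * η} := by
  wlog hij : i ≤ j generalizing i j
  · rw [add_comm (ξ ^ i * η ^ j)]
    exact this j i (by omega)
  obtain ⟨k, rfl⟩ := Nat.exists_eq_add_of_le hij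
  have h : ξ ^ i * η ^ (i + k) + ξ ^ (i + k) * η ^ i = (ξ * η) ^ i * (ξ ^ k + η ^ k) := by ring
  rw [h]
  exact mul_mem (pow_mem (Algebra.subset_adjoin (by simp)) _) (pow_add_pow_mem_adjoin ξ η k)

theorem orbitSum_pow_mem_adjoin {n : ℕ} (ξ η : D) (z : Sym2 (Fin n)) :
    orbitSum (fun i j : Fin n => ξ ^ (i : ℕ) * η ^ (j : ℕ)) z ∈
      Algebra.adjoin R {ξ + η, ξ * η} := by
  induction z with | _ i j
  by_cases hij : i = j
  · subst hij
    rw [orbitSum_diag, ← mul_pow]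
    exact pow_mem (Algebra.subset_adjoin (by simp)) _
  · rw [orbitSum_of_ne _ hij]
    exact pow_mul_pow_add_mem_adjoin ξ η i j

/-- Over a subalgebra `C` containing the sums and products of the conjugate pairs `a, b` and
`c, d`, the pairs of conjugate polynomials in `(a, c)` and `(b, d)` are spanned by
`1, a, c, ac`. -/
theorem exists_coeff_of_mem_adjoin_pair {C : Subalgebra R D} {a b c d : D} (hs : a + b ∈ C)
    (hp : a * b ∈ C) (hs' : c + d ∈ C) (hp' : c * d ∈ C) {u : D × D}
    (hu : u ∈ Algebra.adjoin R {((a, b) : D × D), (c, d)}) :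
    ∃ p q r s : C, u = ((p + q * a + r * c + s * (a * c) : D),
      (p + q * b + r * d + s * (b * d) : D)) := by
  lift a + b to C using hs with A₁ hA₁
  lift a * b to C using hp with A₀ hA₀
  lift c + d to C using hs' with C₁ hC₁
  lift c * d to C using hp' with C₀ hC₀
  induction hu using Algebra.adjoin_induction with
  | mem u hu =>
    rcases hu with rfl | rfl
    · exact ⟨0, 1, 0, 0, by simp⟩
    · exact ⟨0, 0, 1, 0, by simp⟩
  | algebraMap t => exact ⟨algebraMap R C t, 0, 0, 0, by ext <;> simp⟩
  | add u v _ _ hu hv =>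
    obtain ⟨p, q, r, s, rfl⟩ := hu
    obtain ⟨p', q', r', s', rfl⟩ := hv
    exact ⟨p + p', q + q', r + r', s + s', by ext <;> simp <;> ring⟩
  | mul u v _ _ hu hv =>
    obtain ⟨p, q, r, s, rfl⟩ := hu
    obtain ⟨p', q', r', s', rfl⟩ := hv
    -- Multiply out and reduce by `a² = A₁ a - A₀` and `c² = C₁ c - C₀`.
    refine ⟨p * p' - C₀ * (r * r') - A₀ * (q * q' - C₀ * (s * s')),
      (p * q' - C₀ * (r * s')) + (q * p' - C₀ * (s * r')) + A₁ * (q * q' - C₀ * (s * s')),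
      p * r' + r * p' + C₁ * (r * r') - A₀ * (q * s' + s * q' + C₁ * (s * s')),
      (p * s' + r * q' + C₁ * (r * s')) + (q * r' + s * p' + C₁ * (s * r'))
        + A₁ * (q * s' + s * q' + C₁ * (s * s')), ?_⟩
    ext
    · simp only [Prod.fst_mul, Subalgebra.coe_add, Subalgebra.coe_sub, Subalgebra.coe_mul, hA₁,
        hA₀, hC₁, hC₀]
      ring
    · simp only [Prod.snd_mul, Subalgebra.coe_add, Subalgebra.coe_sub, Subalgebra.coe_mul, hA₁,
        hA₀, hC₁, hC₀]
      ring

section Conjugates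

variable {C : Subalgebra R D} {a b c d : D} (hs : a + b ∈ C) (hp : a * b ∈ C) (hs' : c + d ∈ C)
  (hp' : c * d ∈ C) (hm : a * c + b * d ∈ C)

include hs hp hs' hp' hm

/-- The norm of a pair of conjugates lies in `C`. -/
theorem fst_mul_snd_mem {u : D × D} (hu : u ∈ Algebra.adjoin R {((a, b) : D × D), (c, d)}) :
    u.1 * u.2 ∈ C := by
  obtain ⟨p, q, r, s, rfl⟩ := exists_coeff_of_mem_adjoin_pair hs hp hs' hp' hu
  lift a + b to C using hs with A₁ hA₁
  lift a * b to C using hp with A₀ hA₀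
  lift c + d to C using hs' with C₁ hC₁
  lift c * d to C using hp' with C₀ hC₀
  lift a * c + b * d to C using hm with E hE
  have h : ((p + q * a + r * c + s * (a * c)) * (p + q * b + r * d + s * (b * d)) : D) =
      (p ^ 2 + q ^ 2 * A₀ + r ^ 2 * C₀ + s ^ 2 * A₀ * C₀ + p * q * A₁ + p * r * C₁ + p * s * E
        + q * r * (A₁ * C₁ - E) + q * s * A₀ * C₁ + r * s * C₀ * A₁ : C) := by
    push_cast
    rw [hA₁, hA₀, hC₁, hC₀, hE]
    ring
  rw [h]
  exact SetLike.coe_mem _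

/-- The trace form of two pairs of conjugates lies in `C`, by polarizing the norm. -/
theorem fst_mul_snd_add_mem {u v : D × D}
    (hu : u ∈ Algebra.adjoin R {((a, b) : D × D), (c, d)})
    (hv : v ∈ Algebra.adjoin R {((a, b) : D × D), (c, d)}) :
    u.1 * v.2 + v.1 * u.2 ∈ C := by
  have h : u.1 * v.2 + v.1 * u.2 =
      (u + v).1 * (u + v).2 - u.1 * u.2 - v.1 * v.2 := by
    simp only [Prod.fst_add, Prod.snd_add]
    ring
  rw [h]
  exact sub_mem (sub_mem (fst_mul_snd_mem hs hp hs' hp' hm (add_mem hu hv))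
    (fst_mul_snd_mem hs hp hs' hp' hm hu)) (fst_mul_snd_mem hs hp hs' hp' hm hv)

end Conjugates

/-- The elementary symmetric polynomials in four elements. -/
def elemSymm (x : Fin 4 → D) : Fin 4 → D :=
  ![x 0 + x 1 + x 2 + x 3,
    x 0 * x 1 + x 0 * x 2 + x 0 * x 3 + x 1 * x 2 + x 1 * x 3 + x 2 * x 3,
    x 0 * x 1 * x 2 + x 0 * x 1 * x 3 + x 0 * x 2 * x 3 + x 1 * x 2 * x 3,
    x 0 * x 1 * x 2 * x 3]

/-- The basic `D₄`-invariants of four elements: the elementary symmetric polynomials, and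
`x₀x₂ + x₁x₃` at `none`. -/
def dihedralGen (x : Fin 4 → D) (o : Option (Fin 4)) : D :=
  o.elim (x 0 * x 2 + x 1 * x 3) (elemSymm x)

/-- The subalgebra generated by the basic `D₄`-invariants contains all `D₄`-invariant combinations
of monomials, and does so compatibly with the ideal of coefficients. -/
theorem sum_pow_mem_smul_adjoin_dihedralGen {n : ℕ} (x : Fin 4 → D) {I : Ideal R}
    (c : Fin n → Fin n → Fin n → Fin n → R) (hI : ∀ i j k l, c i j k l ∈ I)
    (hswap : ∀ i j k l, c i j k l = c k j i l) (hrot : ∀ i j k l, c i j k l = c l i j k) :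
    ∑ p : Fin n × Fin n, ∑ q : Fin n × Fin n, c p.1 q.1 p.2 q.2 •
      ((x 0 ^ (p.1 : ℕ) * x 2 ^ (p.2 : ℕ)) * (x 1 ^ (q.1 : ℕ) * x 3 ^ (q.2 : ℕ))) ∈
      I • Subalgebra.toSubmodule (Algebra.adjoin R (Set.range (dihedralGen x))) := by
  set C := Algebra.adjoin R (Set.range (dihedralGen x)) with hC
  have hgen : ∀ o, dihedralGen x o ∈ C := fun o => Algebra.subset_adjoin ⟨o, rfl⟩
  have hswap' : ∀ i j k l, c i j k l = c i l k j := fun i j k l => by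
    rw [hrot i j k l, hswap l i j k, hrot j i l k, hrot k j i l, hrot l k j i]
  have hs : (x 0 + x 2) + (x 1 + x 3) ∈ C := by
    convert hgen (some 0) using 1
    simp [dihedralGen, elemSymm]; ring
  have hs' : x 0 * x 2 + x 1 * x 3 ∈ C := hgen none
  -- In terms of `e₁, …, e₄` and `Λ` this product is `e₂ - Λ`, and the mixed trace below is
  -- `e₁ Λ - e₃`.
  have hp : (x 0 + x 2) * (x 1 + x 3) ∈ C := by
    convert sub_mem (hgen (some 1)) (hgen none) using 1
    simp [dihedralGen, elemSymm]; ring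
  have hp' : (x 0 * x 2) * (x 1 * x 3) ∈ C := by
    convert hgen (some 3) using 1
    simp [dihedralGen, elemSymm]; ring
  have hm : (x 0 + x 2) * (x 0 * x 2) + (x 1 + x 3) * (x 1 * x 3) ∈ C := by
    convert sub_mem (mul_mem (hgen (some 0)) (hgen none)) (hgen (some 2)) using 1
    simp [dihedralGen, elemSymm]; ring
  let w : Fin n → Fin n → D := fun i j => x 0 ^ (i : ℕ) * x 2 ^ (j : ℕ)
  let w' : Fin n → Fin n → D := fun i j => x 1 ^ (i : ℕ) * x 3 ^ (j : ℕ)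
  have hK : ∀ z, ((orbitSum w z, orbitSum w' z) : D × D) ∈
      Algebra.adjoin R {((x 0 + x 2, x 1 + x 3) : D × D), (x 0 * x 2, x 1 * x 3)} := fun z => by
    have h : ((orbitSum w z, orbitSum w' z) : D × D) =
        orbitSum (fun i j : Fin n => ((x 0, x 1) : D × D) ^ (i : ℕ) * (x 2, x 3) ^ (j : ℕ)) z := by
      ext
      · simp [orbitSum, w, Prod.fst_sum]
      · simp [orbitSum, w', Prod.snd_sum]
    rw [h]
    exact orbitSum_pow_mem_adjoin (R := R) ((x 0, x 1) : D × D) (x 2, x 3) z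
  -- Collect the orbits of the two inner factors `S₂`; the outer `S₂` is treated afterwards.
  have hsum : ∑ p : Fin n × Fin n, ∑ q : Fin n × Fin n, c p.1 q.1 p.2 q.2 •
      (w p.1 p.2 * w' q.1 q.2) =
      ∑ r : Sym2 (Fin n) × Sym2 (Fin n),
        Sym2.lift₂ ⟨fun i k j l => c i j k l, fun i k j l => ⟨hswap i j k l, hswap' i j k l⟩⟩
          r.1 r.2 • (orbitSum w r.1 * orbitSum w' r.2) := by
    have h₁ : ∀ p : Fin n × Fin n, ∑ q : Fin n × Fin n, c p.1 q.1 p.2 q.2 •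
        (w p.1 p.2 * w' q.1 q.2) = w p.1 p.2 * ∑ z' : Sym2 (Fin n),
        Sym2.lift ⟨fun j l => c p.1 j p.2 l, fun j l => hswap' _ _ _ _⟩ z' • orbitSum w' z' := by
      intro p
      rw [← sum_smul_eq_sum_orbitSum, Finset.mul_sum]
      exact Finset.sum_congr rfl fun q _ => (mul_smul_comm _ _ _).symm
    rw [Finset.sum_congr rfl fun p _ => h₁ p]
    simp only [Finset.mul_sum]
    rw [Finset.sum_comm]
    refine Eq.trans ?_ (Fintype.sum_prod_type_right _).symm
    refine Finset.sum_congr rfl fun z' _ => ?_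
    induction z' with | _ j l
    have h₂ := sum_smul_eq_sum_orbitSum (fun i k => c i j k l) (fun i k => hswap _ _ _ _) w
    have h₃ := congrArg (· * orbitSum w' s(j, l)) h₂
    simp only [Finset.sum_mul, smul_mul_assoc] at h₃
    simp only [mul_smul_comm]
    refine h₃.trans (Finset.sum_congr rfl fun z _ => ?_)
    induction z with | _ i k
    rfl
  change ∑ p : Fin n × Fin n, ∑ q : Fin n × Fin n, c p.1 q.1 p.2 q.2 •
      (w p.1 p.2 * w' q.1 q.2) ∈ _
  rw [hsum]
  refine sum_smul_mem_smul (c := fun z z' => Sym2.lift₂ ⟨fun i k j l => c i j k l,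
    fun i k j l => ⟨hswap i j k l, hswap' i j k l⟩⟩ z z')
    (F := fun z z' => orbitSum w z * orbitSum w' z') ?_ ?_ ?_ ?_
  · intro z z'
    induction z with | _ i k
    induction z' with | _ j l
    exact (hrot i j k l).trans (hswap l i j k)
  · intro z z'
    induction z with | _ i k
    induction z' with | _ j l
    exact hI i j k l
  · exact fun z => fst_mul_snd_mem hs hp hs' hp' hm (hK z)
  · exact fun z z' => fst_mul_snd_add_mem hs hp hs' hp' hm (hK z) (hK z')

end Dihedral

/-! ### The resolvent relation among the invariants of four variables -/

section Variables

variable {R : Type*} [CommRing R]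

open MvPolynomial

theorem eq_zero_of_X_sub_X_mul_eq_zero {σ : Type*} [DecidableEq σ] {i j : σ} (hij : i ≠ j)
    {p : MvPolynomial σ R} (h : (X i - X j) * p = 0) : p = 0 := by
  -- The shear `X i ↦ X i + X j` turns the difference into the regular element `X i`.
  let shear : MvPolynomial σ R → MvPolynomial σ R →ₐ[R] MvPolynomial σ R := fun t =>
    aeval (Function.update X i t)
  have hcomp : (shear (X i - X j)).comp (shear (X i + X j)) = AlgHom.id R _ := by
    ext1 k
    by_cases hk : k = i
    · subst hk
      simp [shear, hij.symm]
    · simp [shear, hk]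
  have hX : X i * shear (X i + X j) p = 0 := by
    have := congrArg (shear (X i + X j)) h
    simpa [shear, hij.symm] using this
  have hp : shear (X i + X j) p = 0 := (isRegular_X (R := R) (n := i)).left (hX.trans (mul_zero _).symm)
  have := DFunLike.congr_fun hcomp p
  rw [AlgHom.comp_apply, hp, map_zero] at this
  exact this.symm

theorem aeval_esymm {D : Type*} [CommRing D] [Algebra R D] (x : Fin 4 → D) (k : Fin 4) :
    aeval x (esymm (Fin 4) R (k + 1)) = elemSymm x k := by
  have h₁ : Finset.powersetCard 1 (Finset.univ : Finset (Fin 4)) = {{0}, {1}, {2}, {3}} := by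
    decide
  have h₂ : Finset.powersetCard 2 (Finset.univ : Finset (Fin 4)) =
      {{0, 1}, {0, 2}, {0, 3}, {1, 2}, {1, 3}, {2, 3}} := by decide
  have h₃ : Finset.powersetCard 3 (Finset.univ : Finset (Fin 4)) =
      {{0, 1, 2}, {0, 1, 3}, {0, 2, 3}, {1, 2, 3}} := by decide
  have h₄ : Finset.powersetCard 4 (Finset.univ : Finset (Fin 4)) = {{0, 1, 2, 3}} := by decide
  rw [aeval_esymm_eq_multiset_esymm, Finset.esymm_map_val]
  fin_cases k
  · norm_num [elemSymm, h₁]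
    rw [Finset.sum_insert (by decide), Finset.sum_insert (by decide),
      Finset.sum_insert (by decide), Finset.sum_singleton]
    simp; ring
  · norm_num [elemSymm, h₂]
    rw [Finset.sum_insert (by decide), Finset.sum_insert (by decide),
      Finset.sum_insert (by decide), Finset.sum_insert (by decide),
      Finset.sum_insert (by decide), Finset.sum_singleton]
    simp; ring
  · norm_num [elemSymm, h₃]
    rw [Finset.sum_insert (by decide), Finset.sum_insert (by decide),
      Finset.sum_insert (by decide), Finset.sum_singleton]
    simp; ring
  · norm_num [elemSymm, h₄]
    simp; ring

variable (R) in
/-- The substitution of the elementary symmetric polynomials in four variables. -/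
def esymmHom : MvPolynomial (Fin 4) R →ₐ[R] MvPolynomial (Fin 4) R :=
  aeval (elemSymm X)

theorem esymmHom_eq (p : MvPolynomial (Fin 4) R) :
    esymmHom R p = esymmAlgHom (Fin 4) R 4 p := by
  rw [esymmAlgHom_apply, esymmHom]
  congr 2
  funext k
  rw [← aeval_esymm (R := R), aeval_X_left_apply]

theorem esymmHom_injective : Function.Injective (esymmHom R) := fun p q h => by
  rw [esymmHom_eq, esymmHom_eq] at h
  exact esymmAlgHom_fin_injective R (le_refl 4) (Subtype.ext h)

theorem rename_esymmHom (σ : Equiv.Perm (Fin 4)) (p : MvPolynomial (Fin 4) R) :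
    rename σ (esymmHom R p) = esymmHom R p := by
  rw [esymmHom_eq]
  exact (esymmAlgHom (Fin 4) R 4 p).2 σ

/-- `1`, `Λ`, `Λ²` are linearly independent over the symmetric polynomials, because the
differences of the three conjugates of `Λ = X₀X₂ + X₁X₃` are regular. -/
theorem eq_zero_of_quadratic_eq_zero {r₀ r₁ r₂ : MvPolynomial (Fin 4) R}
    (h : esymmHom R r₀ + esymmHom R r₁ * (X 0 * X 2 + X 1 * X 3) +
      esymmHom R r₂ * (X 0 * X 2 + X 1 * X 3) ^ 2 = 0) : r₀ = 0 ∧ r₁ = 0 ∧ r₂ = 0 := by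
  have h' := congrArg (rename (Equiv.swap (0 : Fin 4) 1)) h
  have h'' := congrArg (rename (Equiv.swap (0 : Fin 4) 3)) h
  simp only [map_add, map_mul, map_pow, rename_esymmHom, rename_X, map_zero,
    Equiv.swap_apply_left, Equiv.swap_apply_right,
    show Equiv.swap (0 : Fin 4) 1 2 = 2 by decide, show Equiv.swap (0 : Fin 4) 1 3 = 3 by decide,
    show Equiv.swap (0 : Fin 4) 3 1 = 1 by decide, show Equiv.swap (0 : Fin 4) 3 2 = 2 by decide]
    at h' h''
  have k₁ := eq_zero_of_X_sub_X_mul_eq_zero (R := R) (i := (0 : Fin 4)) (j := 1) (by decide)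
    (p := (X 2 - X 3) * (esymmHom R r₁ + esymmHom R r₂ *
      ((X 0 * X 2 + X 1 * X 3) + (X 1 * X 2 + X 0 * X 3)))) (by linear_combination h - h')
  replace k₁ := eq_zero_of_X_sub_X_mul_eq_zero (by decide) k₁
  have k₂ := eq_zero_of_X_sub_X_mul_eq_zero (R := R) (i := (0 : Fin 4)) (j := 3) (by decide)
    (p := (X 2 - X 1) * (esymmHom R r₁ + esymmHom R r₂ *
      ((X 0 * X 2 + X 1 * X 3) + (X 3 * X 2 + X 1 * X 0)))) (by linear_combination h - h'')
  replace k₂ := eq_zero_of_X_sub_X_mul_eq_zero (by decide) k₂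
  have k₃ := eq_zero_of_X_sub_X_mul_eq_zero (R := R) (i := (1 : Fin 4)) (j := 3) (by decide)
    (p := (X 2 - X 0) * esymmHom R r₂) (by linear_combination k₁ - k₂)
  replace k₃ := eq_zero_of_X_sub_X_mul_eq_zero (by decide) k₃
  rw [k₃, zero_mul, add_zero] at k₁
  rw [k₃, k₁, zero_mul, zero_mul, add_zero, add_zero] at h
  exact ⟨esymmHom_injective (h.trans (map_zero _).symm),
    esymmHom_injective (k₁.trans (map_zero _).symm),
    esymmHom_injective (k₃.trans (map_zero _).symm)⟩

theorem cubicResolvent_monic (s₁ s₂ s₃ s₄ : R) : (cubicResolvent s₁ s₂ s₃ s₄).Monic := by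
  unfold cubicResolvent
  monicity!

theorem cubicResolvent_natDegree [Nontrivial R] (s₁ s₂ s₃ s₄ : R) :
    (cubicResolvent s₁ s₂ s₃ s₄).natDegree = 3 := by
  unfold cubicResolvent
  compute_degree!

theorem eval₂_cubicResolvent {S : Type*} [CommRing S] (π : R →+* S) (s₁ s₂ s₃ s₄ : R) (y : S) :
    (cubicResolvent s₁ s₂ s₃ s₄).eval₂ π y =
      (cubicResolvent (π s₁) (π s₂) (π s₃) (π s₄)).eval y := by
  rw [Polynomial.eval₂_eq_eval_map]
  have h4 : π 4 = 4 := map_ofNat π 4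
  simp [cubicResolvent, h4]

/-- The element `x₀x₂ + x₁x₃` is a root of the resolvent of `∏ (T - xᵢ)`. -/
theorem cubicResolvent_elemSymm_eval {D : Type*} [CommRing D] (x : Fin 4 → D) :
    (cubicResolvent (elemSymm x 0) (elemSymm x 1) (elemSymm x 2) (elemSymm x 3)).eval
      (x 0 * x 2 + x 1 * x 3) = 0 := by
  simp [cubicResolvent, elemSymm]
  ring

/-- Every polynomial relation satisfied by `Λ` over the symmetric polynomials specializes to a
relation satisfied by any root of the specialized resolvent. -/
theorem eval₂_eq_zero_of_isRoot {s : Fin 4 → R} {y : R}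
    (hy : (cubicResolvent (s 0) (s 1) (s 2) (s 3)).IsRoot y)
    {q : Polynomial (MvPolynomial (Fin 4) R)}
    (hq : q.eval₂ (esymmHom R : _ →+* MvPolynomial (Fin 4) R) (X 0 * X 2 + X 1 * X 3) = 0) :
    q.eval₂ (aeval s : MvPolynomial (Fin 4) R →ₐ[R] R).toRingHom y = 0 := by
  set f : Polynomial (MvPolynomial (Fin 4) R) := cubicResolvent (X 0) (X 1) (X 2) (X 3) with hf
  have hmon : f.Monic := cubicResolvent_monic _ _ _ _
  nontriviality R
  have hfΛ : f.eval₂ (esymmHom R : _ →+* MvPolynomial (Fin 4) R) (X 0 * X 2 + X 1 * X 3) = 0 := by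
    rw [hf, eval₂_cubicResolvent]
    simpa [esymmHom] using cubicResolvent_elemSymm_eval (X : Fin 4 → MvPolynomial (Fin 4) R)
  have hfy : f.eval₂ (aeval s : MvPolynomial (Fin 4) R →ₐ[R] R).toRingHom y = 0 := by
    rw [hf, eval₂_cubicResolvent]
    simpa using hy
  have hf3 : f.natDegree = 3 := cubicResolvent_natDegree _ _ _ _
  have hdeg : (q %ₘ f).natDegree < 3 := by
    rw [← hf3]
    refine Polynomial.natDegree_modByMonic_lt q hmon fun h => ?_
    rw [h, Polynomial.natDegree_one] at hf3
    omega
  have hmod : q %ₘ f = 0 := by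
    have hr := hq
    rw [← Polynomial.modByMonic_add_div q f, Polynomial.eval₂_add, Polynomial.eval₂_mul, hfΛ,
      zero_mul, add_zero, Polynomial.eval₂_eq_sum_range' _ hdeg] at hr
    simp only [Finset.sum_range_succ, Finset.sum_range_zero, zero_add, pow_zero, mul_one,
      pow_one] at hr
    obtain ⟨h0, h1, h2⟩ := eq_zero_of_quadratic_eq_zero hr
    ext1 n
    match n with
    | 0 => exact h0
    | 1 => exact h1
    | 2 => exact h2
    | n + 3 => exact Polynomial.coeff_eq_zero_of_natDegree_lt (by omega)
  rw [← Polynomial.modByMonic_add_div q f, hmod, zero_add, Polynomial.eval₂_mul, hfy, zero_mul]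

/-- Any relation among the basic `D₄`-invariants of four variables, with coefficients in the
symmetric polynomials, specializes to a relation among `s₁, …, s₄` and any root of the resolvent. -/
theorem eval₂Hom_eq_zero_of_isRoot {s : Fin 4 → R} {y : R}
    (hy : (cubicResolvent (s 0) (s 1) (s 2) (s 3)).IsRoot y)
    {q : MvPolynomial (Option (Fin 4)) (MvPolynomial (Fin 4) R)}
    (hq : eval₂Hom (esymmHom R : _ →+* MvPolynomial (Fin 4) R) (dihedralGen X) q = 0) :
    eval₂Hom (aeval s : MvPolynomial (Fin 4) R →ₐ[R] R).toRingHom (fun o => o.elim y s) q = 0 := by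
  let κ : MvPolynomial (Option (Fin 4)) (MvPolynomial (Fin 4) R) →+*
      Polynomial (MvPolynomial (Fin 4) R) :=
    eval₂Hom Polynomial.C fun o => o.elim Polynomial.X fun k => Polynomial.C (X k)
  have h₁ : eval₂Hom (esymmHom R : _ →+* MvPolynomial (Fin 4) R) (dihedralGen X) =
      (Polynomial.eval₂RingHom (esymmHom R : _ →+* MvPolynomial (Fin 4) R)
        (X 0 * X 2 + X 1 * X 3)).comp κ := by
    refine ringHom_ext (fun r => by simp [κ]) fun o => ?_
    cases o <;> simp [κ, dihedralGen, esymmHom]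
  have h₂ : eval₂Hom (aeval s : MvPolynomial (Fin 4) R →ₐ[R] R).toRingHom
      (fun o : Option (Fin 4) => o.elim y s) =
      (Polynomial.eval₂RingHom (aeval s : MvPolynomial (Fin 4) R →ₐ[R] R).toRingHom y).comp κ := by
    refine ringHom_ext (fun r => by simp [κ]) fun o => ?_
    cases o <;> simp [κ]
  rw [h₁] at hq
  rw [h₂]
  exact eval₂_eq_zero_of_isRoot hy hq

end Variables

/-! ### Characteristic polynomials by simultaneous eigenvectors -/

section Charpoly

variable {R S : Type*} [CommRing R] [CommRing S] {n : ℕ}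

open Polynomial Matrix in
/-- If the rows of a matrix `V` with regular determinant are left eigenvectors of `L`, the
characteristic polynomial of `L` is determined by the eigenvalues. -/
theorem charpoly_eq_prod_of_mul_eq_diagonal_mul {V L : Matrix (Fin n) (Fin n) S} {d : Fin n → S}
    (hV : IsRegular V.det) (h : V * L = Matrix.diagonal d * V) :
    L.charpoly = ∏ i, (X - C (d i)) := by
  have hmul : V.map C * L.charmatrix = (Matrix.diagonal d).charmatrix * V.map C := by
    have h' := congrArg (fun N => N.map (C : S →+* S[X])) h
    simp only [Matrix.map_mul] at h'
    simp only [Matrix.charmatrix, RingHom.mapMatrix_apply, mul_sub, sub_mul, h']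
    rw [(Matrix.scalar_commute X (fun r' => Commute.all _ _) (V.map C)).eq]
  have hdet := congrArg Matrix.det hmul
  rw [Matrix.det_mul, Matrix.det_mul, mul_comm] at hdet
  change L.charpoly * _ = (Matrix.diagonal d).charpoly * _ at hdet
  have hC : (V.map C).det = C V.det := (RingHom.map_det C V).symm
  rw [hC, Matrix.charpoly_diagonal] at hdet
  ext k
  have := congrArg (fun p => p.coeff k) hdet
  simp only [coeff_mul_C] at this
  exact hV.right this

variable {A : Type*} [CommRing A] [Algebra R A]

/-- The defining coefficients `s_k(a)` become elementary symmetric functions of the values of `a`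
under homomorphisms whose values at a basis form a matrix of regular determinant. -/
theorem map_s_eq_esymm [Module.Free R A] [Module.Finite R A] (b : Module.Basis (Fin n) R A)
    (ρ : R →+* S) (g : Fin n → A →+* S) (hg : ∀ i r, g i (algebraMap R A r) = ρ r)
    (hV : IsRegular (Matrix.det (Matrix.of fun i j => g i (b j)))) (a : A) {k : ℕ} (hk : k ≤ n) :
    ρ (s R n k a) = MvPolynomial.aeval (fun i => g i a) (MvPolynomial.esymm (Fin n) ℤ k) := by
  have hmul : (Matrix.of fun i j => g i (b j)) * (Algebra.leftMulMatrix b a).map ρ =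
      Matrix.diagonal (fun i => g i a) * Matrix.of fun i j => g i (b j) := by
    ext i j
    rw [Matrix.diagonal_mul, Matrix.mul_apply]
    simp only [Matrix.of_apply, Matrix.map_apply, Algebra.leftMulMatrix_eq_repr_mul]
    conv_rhs => rw [← map_mul, ← b.sum_repr (a * b j), map_sum]
    refine Finset.sum_congr rfl fun l _ => ?_
    rw [Algebra.smul_def, (g i).map_mul, hg, mul_comm]
  have hchar := charpoly_eq_prod_of_mul_eq_diagonal_mul hV hmul
  have hmap : (LinearMap.charpoly (Algebra.lmul R A a)).map ρ =
      ∏ i, (Polynomial.X - Polynomial.C (g i a)) := by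
    rw [← hchar, Matrix.charpoly_map, Algebra.leftMulMatrix_apply, LinearMap.charpoly_toMatrix]
  have hcoeff : ρ ((LinearMap.charpoly (Algebra.lmul R A a)).coeff (n - k)) =
      (-1) ^ k * MvPolynomial.aeval (fun i => g i a) (MvPolynomial.esymm (Fin n) ℤ k) := by
    rw [← Polynomial.coeff_map, hmap]
    have hv := Multiset.prod_X_sub_C_coeff (Finset.univ.val.map fun i => g i a) (k := n - k)
      (by simp)
    have hcard : Multiset.card (Finset.univ.val.map fun i => g i a) - (n - k) = k := by
      simp [Nat.sub_sub_self hk]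
    rw [Multiset.map_map, hcard] at hv
    rw [MvPolynomial.aeval_esymm_eq_multiset_esymm]
    exact hv
  rw [s, map_mul, hcoeff, ← mul_assoc, map_pow, map_neg, map_one, ← mul_pow]
  simp

theorem map_s_of_map_basis {A' : Type*} [CommRing A'] [Algebra S A'] [Module.Free R A]
    [Module.Finite R A] [Module.Free S A'] [Module.Finite S A'] (b : Module.Basis (Fin n) R A)
    (b' : Module.Basis (Fin n) S A') (ρ : R →+* S) (g : A →+* A')
    (hg : ∀ r, g (algebraMap R A r) = algebraMap S A' (ρ r)) (hb : ∀ i, g (b i) = b' i) (a : A)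
    (k : ℕ) : ρ (s R n k a) = s S n k (g a) := by
  have hmat : (Algebra.leftMulMatrix b a).map ρ = Algebra.leftMulMatrix b' (g a) := by
    ext i j
    rw [Matrix.map_apply, Algebra.leftMulMatrix_eq_repr_mul, Algebra.leftMulMatrix_eq_repr_mul,
      ← hb, ← map_mul]
    conv_rhs => rw [← b.sum_repr (a * b j), map_sum]
    simp_rw [Algebra.smul_def, map_mul, hg, hb, ← Algebra.smul_def]
    rw [b'.repr_sum_self]
  rw [s, s, map_mul, map_pow, map_neg, map_one, ← Polynomial.coeff_map]
  congr 2
  rw [← LinearMap.charpoly_toMatrix _ b, ← LinearMap.charpoly_toMatrix _ b',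
    ← Algebra.leftMulMatrix_apply, ← Algebra.leftMulMatrix_apply, ← hmat, Matrix.charpoly_map]

end Charpoly

/-! ### Tensor powers -/

section TensorPower

variable {R : Type*} [CommRing R] {A : Type*} [CommRing A] [Algebra R A] {n : ℕ}

theorem tprod_eq_prod_conj (a : Fin n → A) :
    (PiTensorProduct.tprod R a : TensorPow R A n) = ∏ i, conj R i (a i) := by
  conv_lhs => rw [← Finset.univ_prod_mulSingle a]
  rw [PiTensorProduct.tprod_prod]
  rfl

theorem conj_algebraMap (i : Fin n) (r : R) :
    conj R i (algebraMap R A r) = algebraMap R (TensorPow R A n) r :=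
  AlgHom.commutes _ r

/-- The universal property of the tensor power among commutative rings, for ring homomorphisms
agreeing on the base ring. -/
def liftConj {D : Type*} [CommRing D] (ρ : R →+* D) (g : Fin n → A →+* D)
    (hg : ∀ i r, g i (algebraMap R A r) = ρ r) : TensorPow R A n →+* D :=
  letI := ρ.toAlgebra
  (PiTensorProduct.liftAlgHom (R := R) (A := fun _ : Fin n => A)
    ((MultilinearMap.mkPiAlgebra R (Fin n) D).compLinearMap fun i =>
      ({ g i with commutes' := hg i } : A →ₐ[R] D).toLinearMap)
    (by simp) (by intro x y; simp [Finset.prod_mul_distrib])).toRingHom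

section LiftConj

variable {D : Type*} [CommRing D] (ρ : R →+* D) (g : Fin n → A →+* D)
  (hg : ∀ i r, g i (algebraMap R A r) = ρ r)

theorem liftConj_tprod (a : Fin n → A) :
    liftConj ρ g hg (PiTensorProduct.tprod R a) = ∏ i, g i (a i) := by
  let := ρ.toAlgebra
  exact PiTensorProduct.lift.tprod _

theorem liftConj_conj (i : Fin n) (a : A) : liftConj ρ g hg (conj R i a) = g i a := by
  rw [conj, PiTensorProduct.singleAlgHom_apply, liftConj_tprod,
    Finset.prod_eq_single i (fun j _ hj => by simp [hj]) (by simp)]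
  simp

theorem liftConj_algebraMap (r : R) :
    liftConj ρ g hg (algebraMap R (TensorPow R A n) r) = ρ r := by
  let := ρ.toAlgebra
  exact AlgHom.commutes _ r

end LiftConj

/-- The basis of the tensor power formed by the pure tensors of basis elements. -/
def tensorBasis {κ : Type*} (b : Module.Basis κ R A) :
    Module.Basis (Fin n → κ) R (TensorPow R A n) :=
  Basis.piTensorProduct fun _ => b

theorem tensorBasis_apply {κ : Type*} (b : Module.Basis κ R A) (v : Fin n → κ) :
    tensorBasis b v = ∏ i, conj R i (b (v i)) := by
  rw [tensorBasis, Basis.piTensorProduct_apply, tprod_eq_prod_conj]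

theorem tensorBasis_repr_permute {κ : Type*} (b : Module.Basis κ R A) (σ : Equiv.Perm (Fin n))
    (m : TensorPow R A n) (v : Fin n → κ) :
    (tensorBasis b).repr (permute R A σ m) (v ∘ σ.symm) = (tensorBasis b).repr m v := by
  classical
  suffices h : (tensorBasis b).coord (v ∘ σ.symm) ∘ₗ (permute R A σ).toLinearMap =
      (tensorBasis b).coord v from LinearMap.congr_fun h m
  refine (tensorBasis b).ext fun w => ?_
  have hw : permute R A σ (tensorBasis b w) = tensorBasis b (w ∘ σ.symm) := by
    rw [tensorBasis, Basis.piTensorProduct_apply, Basis.piTensorProduct_apply, permute_tprod]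
    rfl
  have hcomp : w ∘ σ.symm = v ∘ σ.symm ↔ w = v :=
    ⟨fun h => σ.symm.surjective.injective_comp_right h, fun h => by rw [h]⟩
  simp [hw, Finsupp.single_apply, hcomp]

theorem tensorBasis_repr_map {S A' : Type*} [CommRing S] [CommRing A'] [Algebra S A']
    {κ : Type*} [Fintype κ] (b : Module.Basis κ R A) (b' : Module.Basis κ S A') (ρ : R →+* S)
    (β : TensorPow R A n →+* TensorPow S A' n)
    (hρ : ∀ r, β (algebraMap R _ r) = algebraMap S _ (ρ r))
    (hβ : ∀ v, β (tensorBasis b v) = tensorBasis b' v) (m : TensorPow R A n) (v : Fin n → κ) :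
    (tensorBasis b').repr (β m) v = ρ ((tensorBasis b).repr m v) := by
  classical
  conv_lhs => rw [← (tensorBasis b).sum_repr m, map_sum]
  simp_rw [Algebra.smul_def, map_mul, hρ, hβ, ← Algebra.smul_def]
  rw [(tensorBasis b').repr_sum_self]

end TensorPower

/-! ### The tensor power of a monogenic quartic algebra -/

section QuarticAlgebra

variable {R : Type*} [CommRing R]

/-- The quartic algebra `R[x]/(x⁴ - s₁x³ + s₂x² - s₃x + s₄)`; the coefficients are indexed from
zero. -/
abbrev QuarticAlg (s : Fin 4 → R) : Type _ :=
  AdjoinRoot (quartic (s 0) (s 1) (s 2) (s 3))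

/-- The class of `x` in the quartic algebra. -/
abbrev quarticRoot (s : Fin 4 → R) : QuarticAlg s :=
  AdjoinRoot.root (quartic (s 0) (s 1) (s 2) (s 3))

/-- The conjugates of `x` in the fourth tensor power of the quartic algebra. -/
abbrev rootConj (s : Fin 4 → R) (i : Fin 4) : TensorPow R (QuarticAlg s) 4 :=
  conj R i (quarticRoot s)

theorem exists_quarticBasis (s : Fin 4 → R) :
    ∃ b : Module.Basis (Fin 4) R (QuarticAlg s), ∀ i, b i = quarticRoot s ^ (i : ℕ) := by
  rcases subsingleton_or_nontrivial R with hR | hR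
  · have := Module.subsingleton R (QuarticAlg s)
    exact ⟨Module.Basis.ofRepr default, fun i => Subsingleton.elim _ _⟩
  · have hdeg : (quartic (s 0) (s 1) (s 2) (s 3)).natDegree = 4 := by
      unfold quartic
      compute_degree!
    refine ⟨(AdjoinRoot.powerBasis' (quartic_monic (s 0) (s 1) (s 2) (s 3))).basis.reindex
      (finCongr hdeg), fun i => ?_⟩
    rw [Module.Basis.reindex_apply, PowerBasis.basis_eq_pow]
    rfl

/-- The basis `1, x, x², x³` of the quartic algebra (also over the zero ring, where the degree of
the quartic drops). -/
def quarticBasis (s : Fin 4 → R) : Module.Basis (Fin 4) R (QuarticAlg s) :=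
  (exists_quarticBasis s).choose

theorem quarticBasis_apply (s : Fin 4 → R) (i : Fin 4) :
    quarticBasis s i = quarticRoot s ^ (i : ℕ) :=
  (exists_quarticBasis s).choose_spec i

theorem conj_pow {A : Type*} [CommRing A] [Algebra R A] {n : ℕ} (i : Fin n) (a : A) (k : ℕ) :
    conj R i (a ^ k) = conj R i a ^ k :=
  map_pow (PiTensorProduct.singleAlgHom (R := R) (A := fun _ : Fin n => A) i) a k

theorem tensorBasis_quarticBasis (s : Fin 4 → R) (v : Fin 4 → Fin 4) :
    tensorBasis (quarticBasis s) v = ∏ i, rootConj s i ^ (v i : ℕ) := by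
  rw [tensorBasis_apply]
  exact Finset.prod_congr rfl fun i _ => by rw [quarticBasis_apply, conj_pow]

/-- Splitting the exponents into those at positions `0, 2` and those at positions `1, 3`. -/
def splitExponents (X : Type*) : (Fin 4 → X) ≃ (X × X) × (X × X) where
  toFun v := ((v 0, v 2), (v 1, v 3))
  invFun p := ![p.1.1, p.2.1, p.1.2, p.2.2]
  left_inv v := by
    funext i
    fin_cases i <;> rfl
  right_inv _ := rfl

/-- A `D₄`-invariant tensor with coordinates in an ideal `I` is an `I`-linear combination of
products of the basic invariants. -/
theorem mem_smul_adjoin_of_mem_invariants (s : Fin 4 → R) {I : Ideal R}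
    {m : TensorPow R (QuarticAlg s) 4} (hm : m ∈ invariants R (QuarticAlg s) D4)
    (hI : ∀ v, (tensorBasis (quarticBasis s)).repr m v ∈ I) :
    m ∈ I • Subalgebra.toSubmodule (Algebra.adjoin R (Set.range (dihedralGen (rootConj s)))) := by
  set c := (tensorBasis (quarticBasis s)).repr m with hc
  have hinv : ∀ σ ∈ D4, ∀ v, c (v ∘ σ.symm) = c v := fun σ hσ v => by
    have h := tensorBasis_repr_permute (quarticBasis s) σ m v
    rwa [hm σ hσ] at h
  have hswap : ∀ i j k l, c ![i, j, k, l] = c ![k, j, i, l] := fun i j k l => by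
    rw [← hinv _ (Subgroup.subset_closure (Set.mem_insert _ _)) ![i, j, k, l]]
    congr 1
    funext a
    fin_cases a <;> rfl
  have hrot : ∀ i j k l, c ![i, j, k, l] = c ![l, i, j, k] := fun i j k l => by
    rw [← hinv _ (Subgroup.subset_closure (Set.mem_insert_of_mem _ rfl)) ![i, j, k, l]]
    congr 1
    funext a
    fin_cases a <;> rfl
  have hsum := sum_pow_mem_smul_adjoin_dihedralGen (rootConj s)
    (fun i j k l => c ![i, j, k, l]) (fun i j k l => hI _) hswap hrot
  convert hsum using 1
  rw [← (tensorBasis (quarticBasis s)).sum_repr m, ← hc, ← Fintype.sum_prod_type',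
    ← (splitExponents (Fin 4)).symm.sum_comp]
  refine Finset.sum_congr rfl fun p _ => ?_
  rw [tensorBasis_quarticBasis, Fin.prod_univ_four]
  congr 1
  change rootConj s 0 ^ (p.1.1 : ℕ) * rootConj s 1 ^ (p.2.1 : ℕ) * rootConj s 2 ^ (p.1.2 : ℕ) *
    rootConj s 3 ^ (p.2.2 : ℕ) = _
  ring

theorem map_aeval_esymm {σ D E : Type*} [Fintype σ] [CommRing D] [CommRing E] [Algebra R D]
    {S : Type*} [CommRing S] [Algebra S E] (f : D →+* E) (x : σ → D) (k : ℕ) :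
    f (MvPolynomial.aeval x (MvPolynomial.esymm σ R k)) =
      MvPolynomial.aeval (fun i => f (x i)) (MvPolynomial.esymm σ S k) := by
  simp [MvPolynomial.esymm, map_sum, map_prod]

theorem map_dihedralGen {D E : Type*} [CommRing D] [CommRing E] (f : D →+* E) (x : Fin 4 → D)
    (o : Option (Fin 4)) : f (dihedralGen x o) = dihedralGen (fun i => f (x i)) o := by
  cases o with
  | none => simp [dihedralGen]
  | some k => fin_cases k <;> simp [dihedralGen, elemSymm]

theorem coe_e {A : Type*} [CommRing A] [Algebra R A] {n : ℕ} (G : Subgroup (Equiv.Perm (Fin n)))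
    (k : ℕ) (a : A) : (e R G k a : TensorPow R A n) =
      MvPolynomial.aeval (fun i => conj R i a) (MvPolynomial.esymm (Fin n) R k) :=
  rfl

theorem dihedralGen_mem_invariants (s : Fin 4 → R) (o : Option (Fin 4)) :
    dihedralGen (rootConj s) o ∈ invariants R (QuarticAlg s) D4 := by
  cases o with
  | none => exact (Lam R (quarticRoot s)).2
  | some k =>
    have h := (e R D4 (k + 1) (quarticRoot s)).2
    rwa [coe_e, aeval_esymm] at h

/-- Evaluation of polynomials at the basic `D₄`-invariants of the conjugates of `x`. -/
def evalInvariants (s : Fin 4 → R) :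
    MvPolynomial (Option (Fin 4)) R →ₐ[R] invariants R (QuarticAlg s) D4 :=
  MvPolynomial.aeval fun o => ⟨dihedralGen (rootConj s) o, dihedralGen_mem_invariants s o⟩

theorem coe_evalInvariants (s : Fin 4 → R) (q : MvPolynomial (Option (Fin 4)) R) :
    (evalInvariants s q : TensorPow R (QuarticAlg s) 4) =
      MvPolynomial.aeval (dihedralGen (rootConj s)) q := by
  have h := MvPolynomial.comp_aeval_apply
    (fun o => (⟨dihedralGen (rootConj s) o, dihedralGen_mem_invariants s o⟩ :
      invariants R (QuarticAlg s) D4)) (invariants R (QuarticAlg s) D4).val q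
  exact h

/-- The lift of an invariant tensor to a polynomial in the basic invariants respects ideals of
coordinates. -/
theorem exists_evalInvariants_eq (s : Fin 4 → R) {I : Ideal R}
    (m : invariants R (QuarticAlg s) D4)
    (hI : ∀ v, (tensorBasis (quarticBasis s)).repr (m : TensorPow R (QuarticAlg s) 4) v ∈ I) :
    ∃ q ∈ I • (⊤ : Submodule R (MvPolynomial (Option (Fin 4)) R)), evalInvariants s q = m := by
  have h := mem_smul_adjoin_of_mem_invariants s m.2 hI
  rw [Algebra.adjoin_range_eq_range_aeval, ← Algebra.map_top, Subalgebra.map_toSubmodule,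
    Algebra.top_toSubmodule, ← Submodule.map_smul''] at h
  obtain ⟨q, hq, hqm⟩ := h
  exact ⟨q, hq, Subtype.ext ((coe_evalInvariants s q).trans hqm)⟩

/-- The basic invariants generate the algebra of `D₄`-invariant tensors. -/
theorem evalInvariants_surjective (s : Fin 4 → R) : Function.Surjective (evalInvariants s) :=
  fun m => by
    obtain ⟨q, -, hq⟩ := exists_evalInvariants_eq s (I := ⊤) m fun _ => trivial
    exact ⟨q, hq⟩

end QuarticAlgebra

/-! ### Specialization of the generic quartic algebra -/

section Generic

variable {R : Type*} [CommRing R]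

open MvPolynomial

/-- The specialization of the generic coefficients to `s₁, …, s₄`. -/
abbrev specialize (s : Fin 4 → R) : MvPolynomial (Fin 4) R →+* R :=
  (aeval s : MvPolynomial (Fin 4) R →ₐ[R] R).toRingHom

theorem eval₂_quartic {S : Type*} [CommRing S] (π : R →+* S) (s₁ s₂ s₃ s₄ : R) (y : S) :
    (quartic s₁ s₂ s₃ s₄).eval₂ π y = (quartic (π s₁) (π s₂) (π s₃) (π s₄)).eval y := by
  rw [Polynomial.eval₂_eq_eval_map]
  simp [quartic]

theorem quartic_elemSymm_eval {D : Type*} [CommRing D] (x : Fin 4 → D) (i : Fin 4) :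
    (quartic (elemSymm x 0) (elemSymm x 1) (elemSymm x 2) (elemSymm x 3)).eval (x i) = 0 := by
  fin_cases i <;> simp [quartic, elemSymm] <;> ring

/-- The specialization of the generic quartic algebra to a given one. -/
def specializeAlg (s : Fin 4 → R) :
    QuarticAlg (X : Fin 4 → MvPolynomial (Fin 4) R) →+* QuarticAlg s :=
  AdjoinRoot.lift ((algebraMap R (QuarticAlg s)).comp (specialize s)) (quarticRoot s) (by
    have h := AdjoinRoot.eval₂_root (quartic (s 0) (s 1) (s 2) (s 3))
    rw [eval₂_quartic] at h ⊢
    simpa using h)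

theorem specializeAlg_algebraMap (s : Fin 4 → R) (r : MvPolynomial (Fin 4) R) :
    specializeAlg s (algebraMap _ _ r) = algebraMap R _ (specialize s r) :=
  AdjoinRoot.lift_of _

theorem specializeAlg_root (s : Fin 4 → R) :
    specializeAlg s (quarticRoot X) = quarticRoot s :=
  AdjoinRoot.lift_root _

theorem specializeAlg_surjective (s : Fin 4 → R) : Function.Surjective (specializeAlg s) :=
  fun a => by
    rw [← (quarticBasis s).sum_repr a]
    refine ⟨∑ i, (C ((quarticBasis s).repr a i) : MvPolynomial (Fin 4) R) •
      quarticRoot (X : Fin 4 → MvPolynomial (Fin 4) R) ^ (i : ℕ), ?_⟩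
    simp [Algebra.smul_def, specializeAlg_algebraMap, specializeAlg_root, quarticBasis_apply,
      map_sum, map_mul, map_pow, -AdjoinRoot.algebraMap_eq]

/-- The specialization of the tensor power of the generic quartic algebra. -/
def specializeTensor (s : Fin 4 → R) :
    TensorPow (MvPolynomial (Fin 4) R) (QuarticAlg (X : Fin 4 → MvPolynomial (Fin 4) R)) 4 →+*
      TensorPow R (QuarticAlg s) 4 :=
  liftConj ((algebraMap R (TensorPow R (QuarticAlg s) 4)).comp (specialize s))
    (fun i => (PiTensorProduct.singleAlgHom (R := R) (A := fun _ : Fin 4 => QuarticAlg s) i :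
      QuarticAlg s →+* TensorPow R (QuarticAlg s) 4).comp (specializeAlg s))
    (fun i r => by
      change conj R i (specializeAlg s (algebraMap _ _ r)) = _
      rw [specializeAlg_algebraMap, conj_algebraMap]
      rfl)

theorem specializeTensor_conj (s : Fin 4 → R) (i : Fin 4)
    (a : QuarticAlg (X : Fin 4 → MvPolynomial (Fin 4) R)) :
    specializeTensor s (conj _ i a) = conj R i (specializeAlg s a) :=
  liftConj_conj _ _ _ i a

theorem specializeTensor_algebraMap (s : Fin 4 → R) (r : MvPolynomial (Fin 4) R) :
    specializeTensor s (algebraMap _ _ r) = algebraMap R _ (specialize s r) :=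
  liftConj_algebraMap _ _ _ r

theorem specializeTensor_evalInvariants (s : Fin 4 → R)
    (q : MvPolynomial (Option (Fin 4)) (MvPolynomial (Fin 4) R)) :
    specializeTensor s (evalInvariants X q) = evalInvariants s (map (specialize s) q) := by
  rw [coe_evalInvariants, coe_evalInvariants]
  induction q using MvPolynomial.induction_on with
  | C r =>
    rw [map_C, aeval_C, aeval_C, specializeTensor_algebraMap]
  | add p q hp hq => simp only [map_add, hp, hq]
  | mul_X p o hp =>
    simp only [map_mul, hp, map_X, aeval_X, map_dihedralGen, specializeTensor_conj,
      specializeAlg_root]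

theorem repr_specializeTensor (s : Fin 4 → R)
    (m : TensorPow (MvPolynomial (Fin 4) R) (QuarticAlg (X : Fin 4 → MvPolynomial (Fin 4) R)) 4)
    (v : Fin 4 → Fin 4) :
    (tensorBasis (quarticBasis s)).repr (specializeTensor s m) v =
      specialize s ((tensorBasis (quarticBasis X)).repr m v) := by
  refine tensorBasis_repr_map _ _ _ _ (specializeTensor_algebraMap s) (fun v => ?_) m v
  simp only [tensorBasis_quarticBasis, map_prod, map_pow, specializeTensor_conj,
    specializeAlg_root]

theorem specialize_s (s : Fin 4 → R) (k : ℕ)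
    (a : QuarticAlg (X : Fin 4 → MvPolynomial (Fin 4) R)) :
    specialize s (GClosure.s _ 4 k a) = GClosure.s R 4 k (specializeAlg s a) :=
  map_s_of_map_basis (quarticBasis X) (quarticBasis s) _ _ (specializeAlg_algebraMap s)
    (fun i => by simp only [quarticBasis_apply, map_pow, specializeAlg_root]) a k

variable (R) in
/-- Evaluation of the generic quartic algebra at the `i`-th root of `∏ (T - Xᵢ)`. -/
def evalRoot (i : Fin 4) :
    QuarticAlg (X : Fin 4 → MvPolynomial (Fin 4) R) →+* MvPolynomial (Fin 4) R :=
  AdjoinRoot.lift (esymmHom R : _ →+* MvPolynomial (Fin 4) R) (X i) (by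
    rw [eval₂_quartic]
    simpa [esymmHom] using quartic_elemSymm_eval (X : Fin 4 → MvPolynomial (Fin 4) R) i)

theorem evalRoot_algebraMap (i : Fin 4) (r : MvPolynomial (Fin 4) R) :
    evalRoot R i (algebraMap _ _ r) = (esymmHom R : _ →+* MvPolynomial (Fin 4) R) r :=
  AdjoinRoot.lift_of _

theorem evalRoot_root (i : Fin 4) : evalRoot R i (quarticRoot X) = X i :=
  AdjoinRoot.lift_root _

variable (R) in
/-- The homomorphism sending the conjugates of the generic root to four variables. -/
def evalRoots :
    TensorPow (MvPolynomial (Fin 4) R) (QuarticAlg (X : Fin 4 → MvPolynomial (Fin 4) R)) 4 →+*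
      MvPolynomial (Fin 4) R :=
  liftConj (esymmHom R : _ →+* MvPolynomial (Fin 4) R) (evalRoot R) evalRoot_algebraMap

theorem evalRoots_conj (i : Fin 4) (a : QuarticAlg (X : Fin 4 → MvPolynomial (Fin 4) R)) :
    evalRoots R (conj _ i a) = evalRoot R i a :=
  liftConj_conj _ _ _ i a

theorem evalRoots_evalInvariants
    (q : MvPolynomial (Option (Fin 4)) (MvPolynomial (Fin 4) R)) :
    evalRoots R (evalInvariants X q) =
      eval₂Hom (esymmHom R : _ →+* MvPolynomial (Fin 4) R) (dihedralGen X) q := by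
  rw [coe_evalInvariants]
  induction q using MvPolynomial.induction_on with
  | C r =>
    rw [aeval_C, eval₂Hom_C]
    exact liftConj_algebraMap _ _ _ r
  | add p q hp hq => simp only [map_add, hp, hq]
  | mul_X p o hp =>
    simp only [map_mul, hp, eval₂Hom_X', aeval_X, map_dihedralGen, evalRoots_conj, evalRoot_root]

/-- Over the four variables the characteristic polynomial of `a` splits with roots the conjugates
of `a`. -/
theorem esymmHom_s (a : QuarticAlg (X : Fin 4 → MvPolynomial (Fin 4) R)) {k : ℕ} (hk : k ≤ 4) :
    (esymmHom R : MvPolynomial (Fin 4) R →+* MvPolynomial (Fin 4) R)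
      (GClosure.s _ 4 k a) =
      aeval (fun i => evalRoot R i a) (esymm (Fin 4) ℤ k) := by
  refine map_s_eq_esymm (quarticBasis X) _ (evalRoot R) evalRoot_algebraMap ?_ a hk
  have hV : (Matrix.of fun i j => evalRoot R i (quarticBasis X j)) =
      Matrix.vandermonde (X : Fin 4 → MvPolynomial (Fin 4) R) := by
    ext1 i j
    simp only [Matrix.of_apply, quarticBasis_apply, map_pow, evalRoot_root,
      Matrix.vandermonde_apply]
  rw [hV, Matrix.det_vandermonde]
  refine IsRegular.prod fun i _ => IsRegular.prod fun j hj => ?_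
  rw [isRegular_iff_mem_nonZeroDivisors, mem_nonZeroDivisors_iff_right]
  intro p hp
  rw [mul_comm] at hp
  exact eq_zero_of_X_sub_X_mul_eq_zero (Finset.mem_Ioi.mp hj).ne' hp

theorem evalRoots_e (a : QuarticAlg (X : Fin 4 → MvPolynomial (Fin 4) R)) {k : ℕ} (hk : k ≤ 4) :
    evalRoots R (e (MvPolynomial (Fin 4) R) D4 k a) = (esymmHom R : MvPolynomial (Fin 4) R →+* MvPolynomial (Fin 4) R)
      (GClosure.s _ 4 k a) := by
  rw [esymmHom_s a hk, coe_e, map_aeval_esymm (S := ℤ)]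
  simp only [evalRoots_conj]

theorem specializeTensor_e (s : Fin 4 → R)
    (a : QuarticAlg (X : Fin 4 → MvPolynomial (Fin 4) R)) (k : ℕ) :
    specializeTensor s (e (MvPolynomial (Fin 4) R) D4 k a) = e R D4 k (specializeAlg s a) := by
  rw [coe_e, coe_e, map_aeval_esymm (S := R)]
  simp only [specializeTensor_conj]

/-- The characteristic polynomial of the class of `x` is the defining quartic. -/
theorem s_quarticRoot (s : Fin 4 → R) (k : Fin 4) :
    GClosure.s R 4 (k + 1) (quarticRoot s) = s k := by
  rw [← specializeAlg_root, ← specialize_s]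
  have h : GClosure.s (MvPolynomial (Fin 4) R) 4 (k + 1)
      (quarticRoot (X : Fin 4 → MvPolynomial (Fin 4) R)) = X k := by
    refine esymmHom_injective (R := R) ((esymmHom_s (quarticRoot X) (k := k + 1) (by omega)).trans ?_)
    simp only [evalRoot_root, aeval_esymm, esymmHom, aeval_X]
  rw [h]
  exact aeval_X s k

end Generic

/-! ### Closure data and roots of the resolvent -/

section Correspondence

variable {R : Type*} [CommRing R]

open MvPolynomial

theorem eval₂Hom_specialize_eq (s : Fin 4 → R) (y : R)
    (q : MvPolynomial (Option (Fin 4)) (MvPolynomial (Fin 4) R)) :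
    eval₂Hom (specialize s) (fun o => o.elim y s) q =
      aeval (fun o : Option (Fin 4) => o.elim y s) (map (specialize s) q) := by
  rw [aeval_def, eval₂_map]
  rfl

section Construction

variable {s : Fin 4 → R} {y : R} (hy : (cubicResolvent (s 0) (s 1) (s 2) (s 3)).IsRoot y)

include hy

/-- A relation over the generic coefficients that holds after specialization of the quartic
algebra also holds after specialization of the invariants: subtracting a relation with
coefficients in the kernel of the specialization makes it hold generically. -/
theorem eval₂Hom_eq_zero_of_specializeTensor_eq_zero
    {q : MvPolynomial (Option (Fin 4)) (MvPolynomial (Fin 4) R)}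
    (hq : specializeTensor s (evalInvariants X q) = 0) :
    eval₂Hom (specialize s) (fun o => o.elim y s) q = 0 := by
  obtain ⟨q', hq', hqq'⟩ := exists_evalInvariants_eq X (I := RingHom.ker (specialize s))
    (evalInvariants X q) fun v => by
      rw [RingHom.mem_ker, ← repr_specializeTensor, hq, map_zero, Finsupp.zero_apply]
  have hθ : eval₂Hom (specialize s) (fun o => o.elim y s) q' = 0 := by
    clear hqq'
    induction hq' using Submodule.smul_induction_on' with
    | smul r hr p _ =>
      rw [smul_eq_C_mul, map_mul, eval₂Hom_C, RingHom.mem_ker.mp hr, zero_mul]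
    | add p _ p' _ hp hp' => rw [map_add, hp, hp', add_zero]
  have h := eval₂Hom_eq_zero_of_isRoot hy (q := q - q') (by
    rw [← evalRoots_evalInvariants, map_sub, hqq', sub_self]
    exact map_zero _)
  rw [map_sub, hθ, sub_zero] at h
  exact h

theorem aeval_eq_zero_of_evalInvariants_eq_zero {q : MvPolynomial (Option (Fin 4)) R}
    (hq : evalInvariants s q = 0) : aeval (fun o : Option (Fin 4) => o.elim y s) q = 0 := by
  -- Constant coefficients provide a lift of `q` to the generic ring.
  have hmap : map (specialize s) (map (C : R →+* MvPolynomial (Fin 4) R) q) = q := by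
    rw [map_map]
    convert map_id q
    ext r
    simp
  rw [← hmap, ← eval₂Hom_specialize_eq]
  refine eval₂Hom_eq_zero_of_specializeTensor_eq_zero hy ?_
  rw [specializeTensor_evalInvariants, hmap, hq]
  rfl

/-- The closure datum with value `y` at `Λ(x)`, for a root `y` of the resolvent. -/
def closureDatumOfRoot : ClosureDatum R (QuarticAlg s) 4 D4 where
  toAlgHom := AlgHom.liftOfSurjective (evalInvariants s) (evalInvariants_surjective s)
    (aeval fun o : Option (Fin 4) => o.elim y s)
    fun _ hq => aeval_eq_zero_of_evalInvariants_eq_zero hy hq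
  map_e a k _ hk := by
    obtain ⟨a, rfl⟩ := specializeAlg_surjective s a
    -- Both sides come from the generic algebra, where `e_k(a)` and `s_k(a)` agree among the roots.
    obtain ⟨q, hq⟩ := evalInvariants_surjective X (e _ D4 k a)
    have hs : e R D4 k (specializeAlg s a) = evalInvariants s (map (specialize s) q) :=
      Subtype.ext (by rw [← specializeTensor_e, ← hq, specializeTensor_evalInvariants])
    rw [hs]
    refine (AlgHom.liftOfSurjective_apply _ _ _ _ _).trans ?_
    rw [← eval₂Hom_specialize_eq, ← specialize_s]
    have h := eval₂Hom_eq_zero_of_isRoot hy (q := q - C (GClosure.s _ 4 k a)) (by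
      rw [map_sub, ← evalRoots_evalInvariants, hq, evalRoots_e a hk, eval₂Hom_C, sub_self])
    rwa [map_sub, eval₂Hom_C, sub_eq_zero] at h

theorem closureDatumOfRoot_Lam : (closureDatumOfRoot hy).toAlgHom (Lam R (quarticRoot s)) = y := by
  have h : Lam R (quarticRoot s) = evalInvariants s (X none) :=
    Subtype.ext (by rw [coe_evalInvariants, aeval_X]; rfl)
  rw [h]
  refine (AlgHom.liftOfSurjective_apply _ _ _ _ _).trans ?_
  rw [aeval_X]
  rfl

end Construction

/-- A closure datum is determined by its value at `Λ(x)`. -/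
theorem toAlgHom_evalInvariants {s : Fin 4 → R} (φ : ClosureDatum R (QuarticAlg s) 4 D4)
    (q : MvPolynomial (Option (Fin 4)) R) :
    φ.toAlgHom (evalInvariants s q) =
      aeval (fun o : Option (Fin 4) => o.elim (φ.toAlgHom (Lam R (quarticRoot s))) s) q := by
  rw [evalInvariants, comp_aeval_apply]
  congr 2
  funext o
  cases o with
  | none => rfl
  | some k =>
    have h := φ.map_e (quarticRoot s) (k + 1) (by omega) (by omega)
    rw [s_quarticRoot] at h
    refine Eq.trans ?_ h
    congr 1
    exact Subtype.ext (aeval_esymm _ _).symm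

theorem isRoot_toAlgHom_Lam {s : Fin 4 → R} (φ : ClosureDatum R (QuarticAlg s) 4 D4) :
    (cubicResolvent (s 0) (s 1) (s 2) (s 3)).IsRoot (φ.toAlgHom (Lam R (quarticRoot s))) := by
  let q : MvPolynomial (Option (Fin 4)) R :=
    (cubicResolvent (X (some 0)) (X (some 1)) (X (some 2)) (X (some 3))).eval (X none)
  have hq : evalInvariants s q = 0 := by
    refine Subtype.ext ((coe_evalInvariants s q).trans ?_)
    have h := cubicResolvent_elemSymm_eval (rootConj s)
    simpa [q, cubicResolvent, dihedralGen] using h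
  have h := toAlgHom_evalInvariants φ q
  rw [hq, map_zero] at h
  simpa [q, cubicResolvent] using h.symm

/-- Closure data correspond to roots of the resolvent through their value at `Λ(x)`. -/
def closureDatumEquiv (s : Fin 4 → R) : ClosureDatum R (QuarticAlg s) 4 D4 ≃
    {y : R // (cubicResolvent (s 0) (s 1) (s 2) (s 3)).IsRoot y} where
  toFun φ := ⟨φ.toAlgHom (Lam R (quarticRoot s)), isRoot_toAlgHom_Lam φ⟩
  invFun y := closureDatumOfRoot y.2
  left_inv φ := by
    refine ClosureDatum.ext (AlgHom.ext fun m => ?_)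
    obtain ⟨q, rfl⟩ := evalInvariants_surjective s m
    rw [toAlgHom_evalInvariants, toAlgHom_evalInvariants, closureDatumOfRoot_Lam]
  right_inv y := Subtype.ext (closureDatumOfRoot_Lam y.2)

end Correspondence

end GClosure
end

theorem mainTheorem1 {R : Type*} [CommRing R] (s₁ s₂ s₃ s₄ : R) :
    ∃ Φ : GClosure.ClosureDatum R (AdjoinRoot (GClosure.quartic s₁ s₂ s₃ s₄)) 4 GClosure.D4 ≃
        {y : R // (GClosure.cubicResolvent s₁ s₂ s₃ s₄).IsRoot y},
      ∀ φ, (Φ φ : R) =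
        φ.toAlgHom (GClosure.Lam R (AdjoinRoot.root (GClosure.quartic s₁ s₂ s₃ s₄))) :=
  ⟨GClosure.closureDatumEquiv ![s₁, s₂, s₃, s₄], fun _ => rfl⟩
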